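/- Let $n \ge 0$, let $M$ be a (Hausdorff) smooth real manifold without boundary, and let $\pi : M \to \mathbb{R}^n$ be a smooth family of compact real manifolds, i.e. a smooth proper submersion. Then the family is trivial: there exist a compact (Hausdorff) smooth manifold $F$ without boundary and a $C^\infty$ diffeomorphism $\Phi : M \to \mathbb{R}^n \times F$ such that $\mathrm{pr}_1 \circ \Phi = \pi$. -/

import Mathlib

open scoped Manifold ContDiff

/-- A map `p : M → B` between smooth real manifolds is a smooth family of compact manifolds
(the fibres `p ⁻¹' {b}`, `b : B`) if it is a smooth proper submersion. -/
structure IsSmoothFamily {m n : ℕ}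
    {M : Type*} [TopologicalSpace M] [ChartedSpace (EuclideanSpace ℝ (Fin m)) M]
    {B : Type*} [TopologicalSpace B] [ChartedSpace (EuclideanSpace ℝ (Fin n)) B]
    (p : M → B) : Prop where
  isSubmersion : Manifold.IsSubmersion (𝓡 m) (𝓡 n) ∞ p
  isProperMap : IsProperMap p

/-- A family `p : M → B` is trivial if it is strongly isomorphic (isomorphic by a diffeomorphism
covering the identity of the base `B`) to the product family `Prod.fst : B × F → B` for some
compact smooth manifold `F` (Hausdorff, without boundary). -/
def IsTrivialFamily.{u, v} {m n : ℕ}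
    {M : Type u} [TopologicalSpace M] [ChartedSpace (EuclideanSpace ℝ (Fin m)) M]
    {B : Type v} [TopologicalSpace B] [ChartedSpace (EuclideanSpace ℝ (Fin n)) B]
    (p : M → B) : Prop :=
  ∃ (d : ℕ) (F : Type u) (_ : TopologicalSpace F) (_ : T2Space F) (_ : CompactSpace F)
    (_ : ChartedSpace (EuclideanSpace ℝ (Fin d)) F) (_ : IsManifold (𝓡 d) ∞ F)
    (Φ : Diffeomorph (𝓡 m) ((𝓡 n).prod (𝓡 d)) M (B × F) ∞),
    ∀ x : M, (Φ x).1 = p x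

/-! This is Ehresmann's argument. A submersion is locally a projection (`exists_isAdaptedChart`), so
a constant field on the base lifts locally. The lifts at a point form an affine space, so a
partition of unity glues them (`exists_contMDiff_lift`). An integral curve of a lift covers a
straight line at constant speed. Over bounded time it therefore stays above a closed ball, whose
preimage is compact because `p` is proper, and so the lift is complete.

The flows of lifts of the coordinate fields need not commute, but composing them in some order still
gives diffeomorphisms `A (x, ·)` of `M`, smooth in `x`, that cover translation by `x`. With inverses
`B (x, ·)`, the map `y ↦ (p y, B (p y, y))` trivialises `p`, with the fibre over `0` as model.

Smooth dependence of flows on initial points comes from the implicit function theorem in a Banach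
space of paths: the integral equation is smooth in the path because composition with a smooth map is
a smooth operator (`contDiff_nemytskii`). -/

/-! ### Smoothness of composition operators on spaces of continuous maps -/

section CompositionOperator

open Set Filter Topology

universe u

variable {K : Type*} [TopologicalSpace K] [CompactSpace K]
  {E F : Type u} [NormedAddCommGroup E] [NormedSpace ℝ E]
  [NormedAddCommGroup F] [NormedSpace ℝ F]

/-- Composition with a fixed continuous map `f`, as an operator on spaces of continuous maps. -/
def nemytskii (K : Type*) [TopologicalSpace K] {E F : Type*} [TopologicalSpace E]
    [TopologicalSpace F] (f : C(E, F)) (γ : C(K, E)) : C(K, F) := f.comp γ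

/-- Pointwise application of a continuous family of continuous linear maps. -/
noncomputable def pointwiseApply (K : Type*) [TopologicalSpace K] [CompactSpace K]
    (E F : Type*) [NormedAddCommGroup E] [NormedSpace ℝ E]
    [NormedAddCommGroup F] [NormedSpace ℝ F] :
    C(K, E →L[ℝ] F) →L[ℝ] C(K, E) →L[ℝ] C(K, F) :=
  LinearMap.mkContinuous₂
    (LinearMap.mk₂ ℝ (fun (A : C(K, E →L[ℝ] F)) (h : C(K, E)) =>
        (⟨fun t => A t (h t), by fun_prop⟩ : C(K, F)))
      (fun A B h => by ext t; simp) (fun c A h => by ext t; simp)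
      (fun A h k => by ext t; simp) (fun c A h => by ext t; simp))
    1 fun A h => by
      rw [ContinuousMap.norm_le _ (by positivity)]
      intro t
      simp only [LinearMap.mk₂_apply, ContinuousMap.coe_mk, one_mul]
      exact (A t).le_of_opNorm_le_of_le (A.norm_coe_le_norm t) (h.norm_coe_le_norm t)

theorem hasFDerivAt_nemytskii (f : C(E, F)) (f' : C(E, E →L[ℝ] F))
    (hf : ∀ x, HasFDerivAt f (f' x) x) (γ : C(K, E)) :
    HasFDerivAt (nemytskii K f) (pointwiseApply K E F (nemytskii K f' γ)) γ := by
  rw [hasFDerivAt_iff_isLittleO_nhds_zero, Asymptotics.isLittleO_iff]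
  intro c hc
  have hcont : Continuous (nemytskii K f') := ContinuousMap.continuous_postcomp f'
  obtain ⟨δ, hδ, hb⟩ := 
    (Metric.continuousAt_iff (f := nemytskii K f') (a := γ)).1 hcont.continuousAt c hc
  filter_upwards [Metric.ball_mem_nhds (0 : C(K, E)) hδ] with h hh
  rw [ContinuousMap.norm_le _ (by positivity)]
  intro t
  have hht : ‖h t‖ < δ := (h.norm_coe_le_norm t).trans_lt (by simpa using hh)
  have key : ∀ z ∈ Metric.ball (γ t) δ, ‖f' z - f' (γ t)‖ ≤ c := by
    intro z hz
    -- Every `z` near `γ t` is the value at `t` of a translate of `γ`, so sup-norm continuity of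
    -- composition with `f'` bounds `f'` uniformly in `t`.
    have h1 : dist (γ + ContinuousMap.const K (z - γ t)) γ < δ := by
      rw [dist_eq_norm, add_sub_cancel_left]
      refine lt_of_le_of_lt ((ContinuousMap.norm_le _ (norm_nonneg _)).2 fun s => le_rfl) ?_
      exact mem_ball_iff_norm.1 hz
    have h2 := (ContinuousMap.dist_lt_iff hc).1 (hb h1) t
    simp only [nemytskii, ContinuousMap.comp_apply, ContinuousMap.add_apply,
      ContinuousMap.const_apply, add_sub_cancel, dist_eq_norm] at h2
    exact h2.le
  have := (convex_ball (γ t) δ).norm_image_sub_le_of_norm_hasFDerivWithin_le'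
    (fun z _ => (hf z).hasFDerivWithinAt) key (Metric.mem_ball_self hδ)
    (show γ t + h t ∈ Metric.ball (γ t) δ by simpa [dist_eq_norm] using hht)
  simp only [add_sub_cancel_left] at this
  refine this.trans ?_
  gcongr
  exact h.norm_coe_le_norm t

/-- The derivative is a bounded linear map applied to the composition operator of `f'`, so induction
works once `F` is allowed to vary; `E →L[ℝ] F` must stay in the same universe. -/
theorem contDiff_nat_nemytskii (n : ℕ) : ∀ {F : Type u} [NormedAddCommGroup F] [NormedSpace ℝ F]
    (f : C(E, F)), ContDiff ℝ n f → ContDiff ℝ n (nemytskii K f) := by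
  induction n with
  | zero =>
    intro F _ _ f _
    exact contDiff_zero.2 (ContinuousMap.continuous_postcomp f)
  | succ n ih =>
    intro F _ _ f hf
    obtain ⟨f', hf', hd⟩ := (contDiff_succ_iff_hasFDerivAt (n := n)).1 (by exact_mod_cast hf)
    let g : C(E, E →L[ℝ] F) := ⟨f', hf'.continuous⟩
    have : ContDiff ℝ ((n : WithTop ℕ∞) + 1) (nemytskii K f) :=
      contDiff_succ_iff_hasFDerivAt.2 ⟨_, (pointwiseApply K E F).contDiff.comp (ih g hf'),
        hasFDerivAt_nemytskii f g hd⟩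
    exact_mod_cast this

theorem contDiff_nemytskii (f : C(E, F)) (hf : ContDiff ℝ ∞ f) :
    ContDiff ℝ ∞ (nemytskii K f) :=
  contDiff_infty.2 fun n => contDiff_nat_nemytskii n f (contDiff_infty.1 hf n)

end CompositionOperator

/-! ### Smooth local flows on Banach spaces -/

section LocalFlow

open Set Filter Topology

/-- Integration from `0`, as an operator on continuous paths. -/
noncomputable def integralOperator (E : Type*) [NormedAddCommGroup E] [NormedSpace ℝ E]
    [CompleteSpace E] : C(Icc (0 : ℝ) 1, E) →L[ℝ] C(Icc (0 : ℝ) 1, E) :=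
  LinearMap.mkContinuous
    { toFun := fun γ => ⟨fun t => ∫ s in (0 : ℝ)..t, γ (projIcc 0 1 zero_le_one s),
        (intervalIntegral.continuous_primitive (fun _ _ => Continuous.intervalIntegrable
          (γ.continuous.comp continuous_projIcc) _ _) 0).comp continuous_subtype_val⟩
      map_add' := fun γ η => by
        ext t
        exact intervalIntegral.integral_add
          (Continuous.intervalIntegrable (γ.continuous.comp continuous_projIcc) _ _)
          (Continuous.intervalIntegrable (η.continuous.comp continuous_projIcc) _ _)
      map_smul' := fun c γ => by
        ext t
        exact intervalIntegral.integral_smul c _ }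
    1 fun γ => by
      rw [ContinuousMap.norm_le _ (by positivity)]
      intro t
      refine (intervalIntegral.norm_integral_le_of_norm_le_const
        (fun s _ => γ.norm_coe_le_norm _)).trans ?_
      rw [sub_zero, abs_of_nonneg t.2.1, mul_comm]
      gcongr
      exact t.2.2

universe u

variable {E : Type u} [NormedAddCommGroup E] [NormedSpace ℝ E] [CompleteSpace E]

/-- The zeros of this map are the triples of an initial point `x`, a time `s` and a path `γ` such
that `τ ↦ γ (τ / s)` is a solution of the ODE `y' = f y` starting at `x`. -/
noncomputable def flowEquation (f : C(E, E)) :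
    (E × ℝ) × C(Icc (0 : ℝ) 1, E) → C(Icc (0 : ℝ) 1, E) :=
  fun q => q.2 - ContinuousLinearMap.const ℝ (Icc (0 : ℝ) 1) q.1.1
    - q.1.2 • integralOperator E (nemytskii _ f q.2)

theorem contDiff_flowEquation (f : C(E, E)) (hf : ContDiff ℝ ∞ f) :
    ContDiff ℝ ∞ (flowEquation f) := by
  have h := contDiff_nemytskii (K := Icc (0 : ℝ) 1) f hf
  unfold flowEquation
  fun_prop

/-- At time `0` the integral term vanishes, so the partial derivative in the path is the identity.
-/
theorem isInvertible_fderiv_flowEquation_inr (f : C(E, E)) (hf : ContDiff ℝ ∞ f)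
    (x : E) (γ : C(Icc (0 : ℝ) 1, E)) :
    (fderiv ℝ (flowEquation f) ((x, 0), γ) ∘L .inr ℝ _ _).IsInvertible := by
  have h1 : HasFDerivAt (flowEquation f) (fderiv ℝ (flowEquation f) ((x, 0), γ)) ((x, 0), γ) :=
    ((contDiff_flowEquation f hf).differentiable (by simp)).differentiableAt.hasFDerivAt
  have h2 : HasFDerivAt (fun η : C(Icc (0 : ℝ) 1, E) => ((x, (0 : ℝ)), η))
      (.inr ℝ (E × ℝ) C(Icc (0 : ℝ) 1, E)) γ := hasFDerivAt_prodMk_right _ _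
  have h3 := h1.comp γ h2
  have h4 : HasFDerivAt (flowEquation f ∘ fun η : C(Icc (0 : ℝ) 1, E) => ((x, (0 : ℝ)), η))
      (.id ℝ _) γ := by
    refine ((hasFDerivAt_id γ).sub_const
      (ContinuousLinearMap.const ℝ (Icc (0 : ℝ) 1) x)).congr_of_eventuallyEq ?_
    exact Eventually.of_forall fun η => by simp [flowEquation]
  rw [h3.unique h4]
  exact ⟨.refl ℝ _, rfl⟩

/-- Rescaling time puts solutions of every duration into one path space; the equation is then the
fundamental theorem of calculus. -/
theorem flowEquation_eq_zero (f : C(E, E)) {c : ℝ → E} {s : ℝ}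
    (hc : ∀ t ∈ uIcc 0 s, HasDerivWithinAt c (f (c t)) (uIcc 0 s) t)
    (γ : C(Icc (0 : ℝ) 1, E)) (hγ : ∀ τ, γ τ = c (s * τ)) :
    flowEquation f ((c 0, s), γ) = 0 := by
  ext τ
  have hmem : ∀ σ ∈ Icc (0 : ℝ) 1, s * σ ∈ uIcc 0 s := by
    intro σ hσ
    rcases le_total 0 s with h | h
    · rw [uIcc_of_le h]; constructor <;> nlinarith [hσ.1, hσ.2]
    · rw [uIcc_of_ge h]; constructor <;> nlinarith [hσ.1, hσ.2]
  have hd : ∀ σ ∈ Icc (0 : ℝ) 1,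
      HasDerivWithinAt (fun σ => c (s * σ)) (s • f (c (s * σ))) (Icc 0 1) σ := by
    intro σ hσ
    exact (hc _ (hmem σ hσ)).scomp σ
      (by simpa using ((hasDerivAt_id σ).const_mul s).hasDerivWithinAt) hmem
  have hcont : ContinuousOn (fun σ => c (s * σ)) (Icc 0 1) := fun σ hσ =>
    (hd σ hσ).continuousWithinAt
  have hsub : Icc (0 : ℝ) τ ⊆ Icc 0 1 := Icc_subset_Icc_right τ.2.2
  have key : ∫ σ in (0 : ℝ)..τ, s • f (c (s * σ)) = c (s * τ) - c (s * 0) := by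
    refine intervalIntegral.integral_eq_sub_of_hasDeriv_right_of_le τ.2.1
      (hcont.mono hsub) (fun σ hσ => ?_) ?_
    · refine ((hd σ (hsub (Ioo_subset_Icc_self hσ))).hasDerivAt ?_).hasDerivWithinAt
      exact Icc_mem_nhds hσ.1 (hσ.2.trans_le τ.2.2)
    · refine ContinuousOn.intervalIntegrable ?_
      rw [uIcc_of_le τ.2.1]
      exact ((f.continuous.comp_continuousOn hcont).mono hsub).const_smul s
  have hint : ∫ σ in (0 : ℝ)..τ, f (γ (projIcc 0 1 zero_le_one σ))
      = ∫ σ in (0 : ℝ)..τ, f (c (s * σ)) := by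
    refine intervalIntegral.integral_congr fun σ hσ => ?_
    rw [uIcc_of_le τ.2.1] at hσ
    simp only [hγ, projIcc_of_mem zero_le_one (hsub hσ)]
  rw [intervalIntegral.integral_smul, mul_zero] at key
  change γ τ - c 0 - s • ∫ σ in (0 : ℝ)..τ, f (γ (projIcc 0 1 zero_le_one σ)) = 0
  rw [hint, key, hγ]
  simp

/-- The local flow of a smooth vector field on a Banach space is smooth. -/
theorem exists_contDiffAt_localFlow_of_contDiff {f : E → E} (hf : ContDiff ℝ ∞ f) (x₀ : E) :
    ∃ α : E × ℝ → E, ContDiffAt ℝ ∞ α (x₀, 0) ∧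
      ∀ᶠ q : E × ℝ in 𝓝 (x₀, 0), α (q.1, 0) = q.1 ∧
        HasDerivAt (fun t => α (q.1, t)) (f (α q)) q.2 := by
  let f' : C(E, E) := ⟨f, hf.continuous⟩
  obtain ⟨ε, hε, a, r, L, K, hr, hpl⟩ :=
    IsPicardLindelof.of_contDiffAt_one ((hf.of_le (by norm_cast)).contDiffAt (x := x₀))
  obtain ⟨α, hα, hcont⟩ :=
    (hpl 0).exists_forall_mem_closedBall_eq_hasDerivWithinAt_continuousOn
  simp only [zero_sub, zero_add] at hα hcont
  have hbox : Metric.closedBall x₀ (r : ℝ) ×ˢ Icc (-ε) ε ∈ 𝓝 ((x₀, 0) : E × ℝ) :=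
    prod_mem_nhds (Metric.closedBall_mem_nhds _ hr) (Icc_mem_nhds (by linarith) hε)
  have hbox' : Metric.closedBall x₀ (r : ℝ) ×ˢ Ioo (-ε) ε ∈ 𝓝 ((x₀, 0) : E × ℝ) :=
    prod_mem_nhds (Metric.closedBall_mem_nhds _ hr) (Ioo_mem_nhds (by linarith) hε)
  have hα0 : α (x₀, 0) = x₀ := (hα x₀ (Metric.mem_closedBall_self r.2)).1
  have hcα : ContinuousAt α (x₀, 0) := hcont.continuousAt hbox
  refine ⟨α, ?_, ?_⟩
  -- Picard–Lindelöf only gives a continuous `α`. Uniqueness in the implicit function theorem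
  -- identifies it near `(x₀, 0)` with the endpoint of the smooth path-valued solution `ψ`.
  · let u : (E × ℝ) × C(Icc (0 : ℝ) 1, E) := ((x₀, 0), ContinuousMap.const _ x₀)
    have hG := (contDiff_flowEquation f' hf).contDiffAt (x := u)
    have hinv := isInvertible_fderiv_flowEquation_inr f' hf x₀ (ContinuousMap.const _ x₀)
    have hn : (∞ : WithTop ℕ∞) ≠ 0 := by simp
    have hψ := hG.contDiffAt_implicitFunction hn hinv
    have huniq := hG.eventually_apply_eq_iff_implicitFunction hn hinv
    set ψ := hG.implicitFunction hn hinv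
    let ev : C(Icc (0 : ℝ) 1, E) →L[ℝ] E :=
      ContinuousMap.evalCLM ℝ ⟨1, right_mem_Icc.2 zero_le_one⟩
    have hev : ContDiffAt ℝ ∞ (fun q => ev (ψ q)) (x₀, (0 : ℝ)) :=
      ev.contDiff.contDiffAt.comp _ hψ
    refine hev.congr_of_eventuallyEq ?_
    rw [show u = ((x₀, (0 : ℝ)), ContinuousMap.const _ x₀) from rfl, nhds_prod_eq,
      eventually_prod_iff] at huniq
    obtain ⟨P, hP, Q, hQ, hPQ⟩ := huniq
    obtain ⟨η, hη, hQη⟩ := Metric.eventually_nhds_iff.1 hQ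
    obtain ⟨δ, hδ, hαδ⟩ := Metric.continuousAt_iff.1 hcα (η / 2) (half_pos hη)
    rw [hα0] at hαδ
    filter_upwards [hP, hbox', Metric.ball_mem_nhds _ hδ] with ⟨x, s⟩ hPq hq hqδ
    have hsub : uIcc 0 s ⊆ Icc (-ε) ε := by
      exact uIcc_subset_Icc ⟨by linarith, hε.le⟩ ⟨hq.2.1.le, hq.2.2.le⟩
    have hxs := hα x hq.1
    have habs : ∀ τ ∈ Icc (0 : ℝ) 1, |s * τ| ≤ |s| := fun τ hτ => by
      rw [abs_mul, abs_of_nonneg hτ.1]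
      exact mul_le_of_le_one_right (abs_nonneg _) hτ.2
    have hsε : |s| < ε := abs_lt.2 ⟨hq.2.1, hq.2.2⟩
    let γ : C(Icc (0 : ℝ) 1, E) := ⟨fun τ => α (x, s * τ), by
      refine hcont.comp_continuous (f := fun τ : Icc (0 : ℝ) 1 => (x, s * (τ : ℝ)))
        (by fun_prop) fun τ => ⟨hq.1, ?_⟩
      have := abs_le.1 ((habs τ τ.2).trans hsε.le)
      exact ⟨this.1, this.2⟩⟩
    have hzero : flowEquation f' ((x, s), γ) = 0 := by
      have := flowEquation_eq_zero f' (c := fun t => α (x, t)) (s := s)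
        (fun t ht => (hxs.2 t (hsub ht)).mono hsub) γ fun τ => rfl
      rwa [hxs.1] at this
    have hzero₀ : flowEquation f' u = 0 := by
      ext τ
      simp [flowEquation, u]
    have hγ : dist γ (ContinuousMap.const _ x₀) < η := by
      refine lt_of_le_of_lt ((ContinuousMap.dist_le (half_pos hη).le).2 fun τ => ?_)
        (half_lt_self hη)
      refine (hαδ ?_).le
      have : dist (x, s) (x₀, (0 : ℝ)) < δ := hqδ
      rw [Prod.dist_eq, max_lt_iff] at this ⊢
      refine ⟨this.1, lt_of_le_of_lt ?_ this.2⟩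
      simpa [Real.dist_eq] using habs τ τ.2
    have := (hPQ hPq (hQη hγ)).1 (hzero.trans hzero₀.symm)
    simp only at this
    rw [this]
    simp [γ, ev]
  · filter_upwards [hbox'] with q hq
    have := hα q.1 hq.1
    exact ⟨this.1, (this.2 q.2 (Ioo_subset_Icc_self hq.2)).hasDerivAt
      (Icc_mem_nhds hq.2.1 hq.2.2)⟩

/-- A bump function makes the field global without changing it near `x₀`, where short-time orbits
remain. -/
theorem exists_contDiffAt_localFlow [FiniteDimensional ℝ E] {f : E → E} {U : Set E}
    (hU : IsOpen U) (hf : ContDiffOn ℝ ∞ f U) {x₀ : E} (hx₀ : x₀ ∈ U) :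
    ∃ α : E × ℝ → E, ContDiffAt ℝ ∞ α (x₀, 0) ∧
      ∀ᶠ q : E × ℝ in 𝓝 (x₀, 0), α (q.1, 0) = q.1 ∧ α q ∈ U ∧
        HasDerivAt (fun t => α (q.1, t)) (f (α q)) q.2 := by
  obtain ⟨R, hR, hRU⟩ := Metric.isOpen_iff.1 hU x₀ hx₀
  let b : ContDiffBump x₀ := ⟨R / 4, R / 2, by positivity, by linarith⟩
  have hg : ContDiff ℝ ∞ (fun x => b x • f x) := by
    rw [contDiff_iff_contDiffAt]
    intro x
    by_cases hx : x ∈ U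
    · exact b.contDiff.contDiffAt.smul (hf.contDiffAt (hU.mem_nhds hx))
    · refine (contDiffAt_const (c := (0 : E))).congr_of_eventuallyEq ?_
      have hx' : x ∉ tsupport b := by
        rw [b.tsupport_eq]
        exact fun h => hx (hRU (lt_of_le_of_lt h (half_lt_self hR)))
      filter_upwards [(isClosed_tsupport b).isOpen_compl.mem_nhds hx'] with y hy
      simp [image_eq_zero_of_notMem_tsupport hy]
  obtain ⟨α, hα, hev⟩ := exists_contDiffAt_localFlow_of_contDiff hg x₀
  refine ⟨α, hα, ?_⟩
  have h0 : α (x₀, 0) = x₀ := hev.self_of_nhds.1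
  have h1 : ∀ᶠ q in 𝓝 (x₀, (0 : ℝ)), α q ∈ Metric.ball x₀ (R / 4) :=
    hα.continuousAt (by rw [h0]; exact Metric.ball_mem_nhds _ (by positivity))
  filter_upwards [hev, h1] with q hq hq1
  refine ⟨hq.1, hRU (Metric.ball_subset_ball (by linarith) hq1), ?_⟩
  simpa [b.one_of_mem_closedBall (Metric.ball_subset_closedBall hq1)] using hq.2

end LocalFlow

/-! ### Smooth local flows on manifolds -/

section ManifoldFlow

open Set Filter Topology

variable {E : Type*} [NormedAddCommGroup E] [NormedSpace ℝ E]
  {M : Type*} [TopologicalSpace M] [ChartedSpace E M] [IsManifold 𝓘(ℝ, E) ∞ M]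

/-- The preimage in `M` of an integral curve of the coordinate expression of a vector field is an
integral curve. -/
theorem hasMFDerivAt_extChartAt_symm_comp {v : ∀ x : M, TangentSpace 𝓘(ℝ, E) x} {x₀ : M}
    {c : ℝ → E} {t : ℝ} (hct : c t ∈ (extChartAt 𝓘(ℝ, E) x₀).target)
    (h : HasDerivAt c (tangentCoordChange 𝓘(ℝ, E) ((extChartAt 𝓘(ℝ, E) x₀).symm (c t)) x₀
      ((extChartAt 𝓘(ℝ, E) x₀).symm (c t)) (v ((extChartAt 𝓘(ℝ, E) x₀).symm (c t)))) t) :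
    HasMFDerivAt 𝓘(ℝ, ℝ) 𝓘(ℝ, E) (fun t => (extChartAt 𝓘(ℝ, E) x₀).symm (c t)) t
      ((1 : ℝ →L[ℝ] ℝ).smulRight (v ((extChartAt 𝓘(ℝ, E) x₀).symm (c t)))) := by
  have : IsManifold 𝓘(ℝ, E) 1 M := .of_le (n := ∞) (by norm_cast)
  set xₜ : M := (extChartAt 𝓘(ℝ, E) x₀).symm (c t) with hx
  have hft1 : xₜ ∈ (extChartAt 𝓘(ℝ, E) x₀).source := (extChartAt 𝓘(ℝ, E) x₀).map_target hct
  have hft2 := mem_extChartAt_source (I := 𝓘(ℝ, E)) xₜ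
  let w : E := v xₜ
  have key : HasDerivAt ((extChartAt 𝓘(ℝ, E) xₜ ∘ (extChartAt 𝓘(ℝ, E) x₀).symm) ∘ c) w t := by
    have hw : tangentCoordChange 𝓘(ℝ, E) x₀ xₜ xₜ (tangentCoordChange 𝓘(ℝ, E) xₜ x₀ xₜ w) = w :=
      (tangentCoordChange_comp (x := x₀) ⟨⟨hft2, hft1⟩, hft2⟩).trans
        (tangentCoordChange_self (I := 𝓘(ℝ, E)) (x := xₜ) (z := xₜ) hft2)
    rw [← hw]
    refine HasFDerivAt.comp_hasDerivAt t ?_ h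
    apply HasFDerivWithinAt.hasFDerivAt (s := range 𝓘(ℝ, E)) _ (by simp)
    rw [← (extChartAt 𝓘(ℝ, E) x₀).right_inv hct]
    exact hasFDerivWithinAt_tangentCoordChange ⟨hft1, hft2⟩
  have key' : HasFDerivAt ((extChartAt 𝓘(ℝ, E) xₜ ∘ (extChartAt 𝓘(ℝ, E) x₀).symm) ∘ c)
      ((1 : ℝ →L[ℝ] ℝ).smulRight w) t := by
    have hsmul : (1 : ℝ →L[ℝ] ℝ).smulRight w = ContinuousLinearMap.toSpanSingleton ℝ w := by
      ext
      simp
    rw [hsmul]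
    exact key.hasFDerivAt
  exact ⟨(continuousAt_extChartAt_symm'' hct).comp h.continuousAt, key'.hasFDerivWithinAt⟩

theorem contDiffOn_vectorField_extChartAt {v : ∀ x : M, TangentSpace 𝓘(ℝ, E) x}
    (hv : ContMDiff 𝓘(ℝ, E) 𝓘(ℝ, E).tangent ∞ (fun x => (⟨x, v x⟩ : TangentBundle 𝓘(ℝ, E) M)))
    (x₀ : M) :
    ContDiffOn ℝ ∞ (fun u => tangentCoordChange 𝓘(ℝ, E) ((extChartAt 𝓘(ℝ, E) x₀).symm u) x₀
      ((extChartAt 𝓘(ℝ, E) x₀).symm u) (v ((extChartAt 𝓘(ℝ, E) x₀).symm u)))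
      (extChartAt 𝓘(ℝ, E) x₀).target := by
  rw [← contMDiffOn_iff_contDiffOn]
  have h1 : ContMDiffOn 𝓘(ℝ, E) 𝓘(ℝ, E).tangent ∞
      (fun u => (⟨(extChartAt 𝓘(ℝ, E) x₀).symm u, v ((extChartAt 𝓘(ℝ, E) x₀).symm u)⟩ :
        TangentBundle 𝓘(ℝ, E) M)) (extChartAt 𝓘(ℝ, E) x₀).target :=
    hv.comp_contMDiffOn (contMDiffOn_extChartAt_symm x₀)
  have : IsManifold 𝓘(ℝ, E) 1 M := .of_le (n := ∞) (by norm_cast)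
  have h2 := ((trivializationAt E (TangentSpace 𝓘(ℝ, E)) x₀).contMDiffOn_iff fun u hu => by
    simpa using (extChartAt 𝓘(ℝ, E) x₀).map_target hu).1 h1
  exact h2.2

/-- The local flow of a smooth vector field on a manifold is smooth. -/
theorem exists_contMDiffAt_localFlow [FiniteDimensional ℝ E] {v : ∀ x : M, TangentSpace 𝓘(ℝ, E) x}
    (hv : ContMDiff 𝓘(ℝ, E) 𝓘(ℝ, E).tangent ∞ (fun x => (⟨x, v x⟩ : TangentBundle 𝓘(ℝ, E) M)))
    (x₀ : M) :
    ∃ θ : M × ℝ → M, ContMDiffAt (𝓘(ℝ, E).prod 𝓘(ℝ, ℝ)) 𝓘(ℝ, E) ∞ θ (x₀, 0) ∧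
      ∀ᶠ q : M × ℝ in 𝓝 (x₀, 0), θ (q.1, 0) = q.1 ∧
        HasMFDerivAt 𝓘(ℝ, ℝ) 𝓘(ℝ, E) (fun t => θ (q.1, t)) q.2
          ((1 : ℝ →L[ℝ] ℝ).smulRight (v (θ q))) := by
  set φ := extChartAt 𝓘(ℝ, E) x₀ with hφ
  obtain ⟨α, hα, hev⟩ := exists_contDiffAt_localFlow (isOpen_extChartAt_target x₀)
    (contDiffOn_vectorField_extChartAt hv x₀) (mem_extChartAt_target x₀)
  have hα0 : α (φ x₀, 0) = φ x₀ := hev.self_of_nhds.1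
  have hφs : ContMDiffAt (𝓘(ℝ, E).prod 𝓘(ℝ, ℝ)) (𝓘(ℝ, E).prod 𝓘(ℝ, ℝ)) ∞
      (fun q : M × ℝ => (φ q.1, q.2)) (x₀, 0) :=
    ((contMDiffAt_extChartAt (I := 𝓘(ℝ, E)) (x := x₀)).comp (x₀, (0 : ℝ)) contMDiffAt_fst).prodMk
      contMDiffAt_snd
  refine ⟨fun q => φ.symm (α (φ q.1, q.2)), ?_, ?_⟩
  · have h1 : ContMDiffAt (𝓘(ℝ, E).prod 𝓘(ℝ, ℝ)) 𝓘(ℝ, E) ∞ α (φ x₀, 0) := by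
      rw [← modelWithCornersSelf_prod, chartedSpaceSelf_prod]
      exact hα.contMDiffAt
    have h2 : ContMDiffAt 𝓘(ℝ, E) 𝓘(ℝ, E) ∞ φ.symm (α (φ x₀, 0)) := by
      rw [hα0]
      exact (contMDiffOn_extChartAt_symm x₀).contMDiffAt (extChartAt_target_mem_nhds x₀)
    exact h2.comp (x₀, (0 : ℝ)) (h1.comp (x₀, (0 : ℝ)) hφs)
  · have hsrc : ∀ᶠ q : M × ℝ in 𝓝 (x₀, 0), q.1 ∈ φ.source :=
      continuousAt_fst.eventually (extChartAt_source_mem_nhds x₀)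
    filter_upwards [hφs.continuousAt.eventually hev, hsrc] with q hq hqs
    refine ⟨by rw [hq.1, φ.left_inv hqs], ?_⟩
    exact hasMFDerivAt_extChartAt_symm_comp (c := fun t => α (φ q.1, t)) hq.2.1 hq.2.2

end ManifoldFlow

/-! ### Smoothness of global flows -/

section CompleteFlow

open Set Filter Topology Function

variable {E : Type*} [NormedAddCommGroup E] [NormedSpace ℝ E]
  {M : Type*} [TopologicalSpace M] [ChartedSpace E M] [IsManifold 𝓘(ℝ, E) ∞ M] [T2Space M]
  {v : ∀ x : M, TangentSpace 𝓘(ℝ, E) x}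

theorem flow_add {Θ : M → ℝ → M} (hv : ContMDiff 𝓘(ℝ, E) 𝓘(ℝ, E).tangent ∞
      (fun x => (⟨x, v x⟩ : TangentBundle 𝓘(ℝ, E) M)))
    (h0 : ∀ x, Θ x 0 = x) (hΘ : ∀ x, IsMIntegralCurve (Θ x) v) (x : M) (s t : ℝ) :
    Θ x (s + t) = Θ (Θ x s) t := by
  have : IsManifold 𝓘(ℝ, E) 1 M := .of_le (n := ∞) (by norm_cast)
  have h := isMIntegralCurve_Ioo_eq_of_contMDiff_boundaryless (t₀ := 0)
    (hv.of_le (by norm_cast)) ((hΘ x).comp_add s) (hΘ (Θ x s)) (by simp [h0])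
  simpa [add_comm] using congrFun h t

variable [FiniteDimensional ℝ E]

theorem contMDiffAt_flow_zero {Θ : M → ℝ → M} (hv : ContMDiff 𝓘(ℝ, E) 𝓘(ℝ, E).tangent ∞
      (fun x => (⟨x, v x⟩ : TangentBundle 𝓘(ℝ, E) M)))
    (h0 : ∀ x, Θ x 0 = x) (hΘ : ∀ x, IsMIntegralCurve (Θ x) v) (x₀ : M) :
    ContMDiffAt (𝓘(ℝ, E).prod 𝓘(ℝ, ℝ)) 𝓘(ℝ, E) ∞ (uncurry Θ) (x₀, 0) := by
  have : IsManifold 𝓘(ℝ, E) 1 M := .of_le (n := ∞) (by norm_cast)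
  obtain ⟨θ, hθ, hev⟩ := exists_contMDiffAt_localFlow hv x₀
  refine hθ.congr_of_eventuallyEq ?_
  rw [nhds_prod_eq, eventually_prod_iff] at hev
  obtain ⟨P, hP, Q, hQ, hPQ⟩ := hev
  obtain ⟨ε, hε, hQε⟩ := Metric.eventually_nhds_iff_ball.1 hQ
  rw [Real.ball_eq_Ioo, zero_sub, zero_add] at hQε
  have hbox : ∀ᶠ q : M × ℝ in 𝓝 (x₀, 0), P q.1 ∧ q.2 ∈ Ioo (-ε) ε :=
    hP.prodMk_nhds (Ioo_mem_nhds (by linarith) hε)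
  filter_upwards [hbox] with ⟨x, t⟩ ⟨hx, ht⟩
  have hzero : (0 : ℝ) ∈ Ioo (-ε) ε := ⟨by linarith, hε⟩
  refine isMIntegralCurveOn_Ioo_eqOn_of_contMDiff_boundaryless hzero (hv.of_le (by norm_cast))
    ((hΘ x).isMIntegralCurveOn _) (γ' := fun t => θ (x, t)) (fun s hs => ?_) ?_ ht
  · exact (hPQ hx (hQε s hs)).2.hasMFDerivWithinAt
  · rw [h0, (hPQ hx (hQε 0 hzero)).1]

/-- The times at which the flow is `C^k` at `x₀` form a clopen subset of `ℝ`. Finite `k` matters: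
being `C^k` at a point is then an open condition. -/
theorem contMDiff_nat_flow {Θ : M → ℝ → M} (hv : ContMDiff 𝓘(ℝ, E) 𝓘(ℝ, E).tangent ∞
      (fun x => (⟨x, v x⟩ : TangentBundle 𝓘(ℝ, E) M)))
    (h0 : ∀ x, Θ x 0 = x) (hΘ : ∀ x, IsMIntegralCurve (Θ x) v) (k : ℕ) :
    ContMDiff (𝓘(ℝ, E).prod 𝓘(ℝ, ℝ)) 𝓘(ℝ, E) k (uncurry Θ) := by
  have hM : IsManifold 𝓘(ℝ, E) k M := .of_le (n := ∞) (by exact_mod_cast le_top)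
  have hnhds : ∀ q : M × ℝ,
      ContMDiffAt (𝓘(ℝ, E).prod 𝓘(ℝ, ℝ)) 𝓘(ℝ, E) k (uncurry Θ) q →
      ∀ᶠ q' in 𝓝 q, ContMDiffAt (𝓘(ℝ, E).prod 𝓘(ℝ, ℝ)) 𝓘(ℝ, E) k (uncurry Θ) q' :=
    fun q hq => (contMDiffAt_iff_contMDiffAt_nhds (by simp)).1 hq
  rintro ⟨x₀, T⟩
  let S : Set ℝ := {t | ContMDiffAt (𝓘(ℝ, E).prod 𝓘(ℝ, ℝ)) 𝓘(ℝ, E) k (uncurry Θ) (x₀, t)}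
  suffices hS : S = univ from (hS ▸ mem_univ T : T ∈ S)
  have hzero : ∀ x, ContMDiffAt (𝓘(ℝ, E).prod 𝓘(ℝ, ℝ)) 𝓘(ℝ, E) k (uncurry Θ) (x, 0) :=
    fun x => (contMDiffAt_flow_zero hv h0 hΘ x).of_le (by exact_mod_cast le_top)
  refine IsClopen.eq_univ ⟨?_, ?_⟩ ⟨0, hzero x₀⟩
  -- Take a good time `s` so close to `t` that the flow is `C^k` at `(Θ x₀ s, t - s)`, then factor
  -- through time `s` by the group law.
  · refine isClosed_of_closure_subset fun t ht => ?_
    have hloc := hnhds _ (hzero (Θ x₀ t))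
    have hcont : ContinuousAt (fun s => (Θ x₀ s, t - s)) t :=
      (hΘ x₀).continuous.continuousAt.prodMk (by fun_prop)
    have hev : ∀ᶠ s in 𝓝 t,
        ContMDiffAt (𝓘(ℝ, E).prod 𝓘(ℝ, ℝ)) 𝓘(ℝ, E) k (uncurry Θ) (Θ x₀ s, t - s) :=
      hcont.eventually (by simpa using hloc)
    obtain ⟨s, hs, hsS⟩ := mem_closure_iff_nhds.1 ht _ hev
    have hinner : ContMDiffAt (𝓘(ℝ, E).prod 𝓘(ℝ, ℝ)) (𝓘(ℝ, E).prod 𝓘(ℝ, ℝ)) k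
        (fun q : M × ℝ => (Θ q.1 s, q.2 - s)) (x₀, t) := by
      refine ContMDiffAt.prodMk ?_ ?_
      · exact ContMDiffAt.comp (x₀, t) (g := uncurry Θ) (f := fun q : M × ℝ => (q.1, s)) hsS
          (contMDiffAt_fst.prodMk contMDiffAt_const)
      · exact contMDiffAt_snd.sub contMDiffAt_const
    have houter : ContMDiffAt (𝓘(ℝ, E).prod 𝓘(ℝ, ℝ)) 𝓘(ℝ, E) k (uncurry Θ) (Θ x₀ s, t - s) := hs
    have := ContMDiffAt.comp (x₀, t) houter hinner
    refine this.congr_of_eventuallyEq (Eventually.of_forall fun q => ?_)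
    simp [uncurry, ← flow_add hv h0 hΘ]
  · rw [isOpen_iff_mem_nhds]
    intro t ht
    exact (Continuous.prodMk_right x₀).continuousAt.eventually (hnhds _ ht)

/-- The flow of a complete smooth vector field is smooth. -/
theorem contMDiff_flow {Θ : M → ℝ → M} (hv : ContMDiff 𝓘(ℝ, E) 𝓘(ℝ, E).tangent ∞
      (fun x => (⟨x, v x⟩ : TangentBundle 𝓘(ℝ, E) M)))
    (h0 : ∀ x, Θ x 0 = x) (hΘ : ∀ x, IsMIntegralCurve (Θ x) v) :
    ContMDiff (𝓘(ℝ, E).prod 𝓘(ℝ, ℝ)) 𝓘(ℝ, E) ∞ (uncurry Θ) :=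
  contMDiff_infty.2 fun k => contMDiff_nat_flow hv h0 hΘ k

end CompleteFlow

/-! ### Completeness of lifts along a proper map -/

section Completeness

open Set Filter Topology Function

variable {E : Type*} [NormedAddCommGroup E] [NormedSpace ℝ E]
  {M : Type*} [TopologicalSpace M] [ChartedSpace E M]
  {v : ∀ x : M, TangentSpace 𝓘(ℝ, E) x}

variable {F : Type*} [NormedAddCommGroup F] [NormedSpace ℝ F] {p : M → F} {e : F}

theorem IsMIntegralCurveOn.eq_add_smul_of_mfderiv_eq (hp : MDifferentiable 𝓘(ℝ, E) 𝓘(ℝ, F) p)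
    (hpv : ∀ x, mfderiv 𝓘(ℝ, E) 𝓘(ℝ, F) p x (v x) = e) {γ : ℝ → M} {a : ℝ}
    (hγ : IsMIntegralCurveOn γ v (Ioo (-a) a)) {t : ℝ} (ht : t ∈ Ioo (-a) a) :
    p (γ t) = p (γ 0) + t • e := by
  have hd : ∀ s ∈ Ioo (-a) a, HasDerivAt (fun s => p (γ s) - s • e) 0 s := by
    intro s hs
    have h1 := (hp (γ s)).hasMFDerivAt.comp s ((hγ s hs).hasMFDerivAt (Ioo_mem_nhds hs.1 hs.2))
    let A : ℝ →L[ℝ] F := (mfderiv 𝓘(ℝ, E) 𝓘(ℝ, F) p (γ s)).comp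
      ((1 : ℝ →L[ℝ] ℝ).smulRight (v (γ s)))
    have h2 : HasFDerivAt (fun s => p (γ s)) A s := hasMFDerivAt_iff_hasFDerivAt.1 h1
    have hA : A 1 = e := by
      refine Eq.trans ?_ (hpv (γ s))
      change mfderiv 𝓘(ℝ, E) 𝓘(ℝ, F) p (γ s) ((1 : ℝ) • v (γ s)) = _
      rw [one_smul]
    have h3 : HasDerivAt (fun s => p (γ s)) e s := hA ▸ h2.hasDerivAt
    have h4 : HasDerivAt (fun s : ℝ => s • e) e s := by
      simpa using (hasDerivAt_id s).smul_const e
    rw [← sub_self e]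
    exact h3.sub h4
  have hconst := isOpen_Ioo.is_const_of_deriv_eq_zero isPreconnected_Ioo
    (fun s hs => (hd s hs).differentiableAt.differentiableWithinAt)
    (fun s hs => (hd s hs).deriv) ht (show (0 : ℝ) ∈ Ioo (-a) a from
      ⟨by linarith [ht.1, ht.2], by linarith [ht.1, ht.2]⟩)
  simp only [zero_smul, sub_zero] at hconst
  rw [← hconst, sub_add_cancel]

variable [IsManifold 𝓘(ℝ, E) ∞ M]

/-- Short curves started `ε / 2` before each end overlap `γ` and reach `ε / 2` beyond it; they are
glued by uniqueness. -/
theorem IsMIntegralCurveOn.exists_extension [T2Space M]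
    (hv : ContMDiff 𝓘(ℝ, E) 𝓘(ℝ, E).tangent ∞
      (fun x => (⟨x, v x⟩ : TangentBundle 𝓘(ℝ, E) M)))
    {γ γ₁ γ₂ : ℝ → M} {a ε : ℝ} (hε : 0 < ε) (ha : ε ≤ a)
    (hγ : IsMIntegralCurveOn γ v (Ioo (-a) a))
    (h₁ : γ₁ 0 = γ (-(a - ε / 2))) (hγ₁ : IsMIntegralCurveOn γ₁ v (Ioo (-ε) ε))
    (h₂ : γ₂ 0 = γ (a - ε / 2)) (hγ₂ : IsMIntegralCurveOn γ₂ v (Ioo (-ε) ε)) :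
    ∃ γ' : ℝ → M, γ' 0 = γ 0 ∧ IsMIntegralCurveOn γ' v (Ioo (-(a + ε / 2)) (a + ε / 2)) := by
  have : IsManifold 𝓘(ℝ, E) 1 M := .of_le (n := ∞) (by norm_cast)
  have hv1 := hv.of_le (n := ∞) (m := 1) (by norm_cast)
  have hγ₁' : IsMIntegralCurveOn (γ₁ ∘ (· + (a - ε / 2))) v
      (Ioo (-(a + ε / 2)) (-a + 3 * ε / 2)) := by
    refine (hγ₁.comp_add (a - ε / 2)).mono fun t ht => ?_
    simp only [mem_ofPred_eq, mem_Ioo] at ht ⊢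
    constructor <;> linarith
  have hγ₂' : IsMIntegralCurveOn (γ₂ ∘ (· + -(a - ε / 2))) v
      (Ioo (a - 3 * ε / 2) (a + ε / 2)) := by
    refine (hγ₂.comp_add (-(a - ε / 2))).mono fun t ht => ?_
    simp only [mem_ofPred_eq, mem_Ioo] at ht ⊢
    constructor <;> linarith
  have hleft := isMIntegralCurveOn_piecewise (t₀ := -(a - ε / 2)) hv1 hγ hγ₁'
    ⟨⟨by linarith, by linarith⟩, ⟨by linarith, by linarith⟩⟩ (by simp [h₁])
  have hleft' := hleft.mono (s' := Ioo (-(a + ε / 2)) a) fun t ht => by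
    by_cases h : -a < t
    · exact Or.inl ⟨h, ht.2⟩
    · exact Or.inr ⟨ht.1, by linarith⟩
  have hboth := isMIntegralCurveOn_piecewise (t₀ := a - ε / 2) hv1 hleft' hγ₂'
    ⟨⟨by linarith, by linarith⟩, ⟨by linarith, by linarith⟩⟩ (by
      rw [piecewise_eq_of_mem _ _ _ (show a - ε / 2 ∈ Ioo (-a) a from
        ⟨by linarith, by linarith⟩)]
      simp [h₂])
  refine ⟨_, ?_, hboth.mono fun t ht => ?_⟩
  · rw [piecewise_eq_of_mem _ _ _ (show (0 : ℝ) ∈ Ioo (-(a + ε / 2)) a from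
        ⟨by linarith, by linarith⟩),
      piecewise_eq_of_mem _ _ _ (show (0 : ℝ) ∈ Ioo (-a) a from ⟨by linarith, by linarith⟩)]
  · by_cases h : t < a
    · exact Or.inl ⟨ht.1, h⟩
    · exact Or.inr ⟨by linarith, ht.2⟩

variable [FiniteDimensional ℝ E]

theorem IsCompact.exists_uniform_isMIntegralCurveOn {K : Set M} (hK : IsCompact K)
    (hv : ContMDiff 𝓘(ℝ, E) 𝓘(ℝ, E).tangent ∞
      (fun x => (⟨x, v x⟩ : TangentBundle 𝓘(ℝ, E) M))) :
    ∃ ε > 0, ∀ x ∈ K, ∃ γ : ℝ → M, γ 0 = x ∧ IsMIntegralCurveOn γ v (Ioo (-ε) ε) := by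
  refine hK.induction_on ⟨1, one_pos, by simp⟩ ?_ ?_ ?_
  · rintro s t hst ⟨ε, hε, h⟩
    exact ⟨ε, hε, fun x hx => h x (hst hx)⟩
  · rintro s t ⟨ε, hε, h⟩ ⟨δ, hδ, h'⟩
    refine ⟨min ε δ, lt_min hε hδ, ?_⟩
    rintro x (hx | hx)
    · obtain ⟨γ, hγ, hγ'⟩ := h x hx
      exact ⟨γ, hγ, hγ'.mono (Ioo_subset_Ioo (neg_le_neg (min_le_left _ _)) (min_le_left _ _))⟩
    · obtain ⟨γ, hγ, hγ'⟩ := h' x hx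
      exact ⟨γ, hγ, hγ'.mono (Ioo_subset_Ioo (neg_le_neg (min_le_right _ _)) (min_le_right _ _))⟩
  · intro x _
    obtain ⟨θ, -, hev⟩ := exists_contMDiffAt_localFlow hv x
    rw [nhds_prod_eq, eventually_prod_iff] at hev
    obtain ⟨P, hP, Q, hQ, hPQ⟩ := hev
    obtain ⟨ε, hε, hQε⟩ := Metric.eventually_nhds_iff_ball.1 hQ
    rw [Real.ball_eq_Ioo, zero_sub, zero_add] at hQε
    refine ⟨{y | P y}, mem_nhdsWithin_of_mem_nhds hP, ε, hε, fun y hy => ?_⟩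
    exact ⟨fun t => θ (y, t), (hPQ hy (hQε 0 ⟨by linarith, hε⟩)).1,
      fun s hs => (hPQ hy (hQε s hs)).2.hasMFDerivWithinAt⟩

/-- A lift of a constant vector field along a proper map is complete. -/
theorem IsProperMap.exists_isMIntegralCurve [T2Space M] [ProperSpace F]
    (hv : ContMDiff 𝓘(ℝ, E) 𝓘(ℝ, E).tangent ∞
      (fun x => (⟨x, v x⟩ : TangentBundle 𝓘(ℝ, E) M)))
    (hprop : IsProperMap p) (hp : MDifferentiable 𝓘(ℝ, E) 𝓘(ℝ, F) p)
    (hpv : ∀ x, mfderiv 𝓘(ℝ, E) 𝓘(ℝ, F) p x (v x) = e) (x : M) :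
    ∃ γ : ℝ → M, γ 0 = x ∧ IsMIntegralCurve γ v := by
  have : IsManifold 𝓘(ℝ, E) 1 M := .of_le (n := ∞) (by norm_cast)
  rw [exists_isMIntegralCurve_iff_exists_isMIntegralCurveOn_Ioo (hv.of_le (by norm_cast))]
  intro b
  obtain ⟨ε, hε, hK⟩ := (hprop.isCompact_preimage
    (isCompact_closedBall (p x) (|b| * ‖e‖))).exists_uniform_isMIntegralCurveOn hv
  have hmem : ∀ {γ : ℝ → M} {a t : ℝ}, γ 0 = x → IsMIntegralCurveOn γ v (Ioo (-a) a) →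
      t ∈ Ioo (-a) a → |t| ≤ |b| → γ t ∈ p ⁻¹' Metric.closedBall (p x) (|b| * ‖e‖) := by
    intro γ a t h0 hγ ht htb
    rw [mem_preimage, hγ.eq_add_smul_of_mfderiv_eq hp hpv ht, h0, Metric.mem_closedBall,
      dist_eq_norm, add_sub_cancel_left, norm_smul, Real.norm_eq_abs]
    gcongr
  -- Each round gains `ε / 2`. The `min` allows stopping at `b`, since the uniform `ε` is only valid
  -- for times bounded by `|b|`.
  have hind : ∀ k : ℕ, ∃ a, ε ≤ a ∧ min b (ε + k * (ε / 2)) ≤ a ∧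
      ∃ γ : ℝ → M, γ 0 = x ∧ IsMIntegralCurveOn γ v (Ioo (-a) a) := by
    intro k
    induction k with
    | zero =>
      refine ⟨ε, le_rfl, by simp, hK x ?_⟩
      simpa using by positivity
    | succ k ih =>
      obtain ⟨a, ha, hka, γ, h0, hγ⟩ := ih
      by_cases hab : b ≤ a
      · exact ⟨a, ha, (min_le_left _ _).trans hab, γ, h0, hγ⟩
      have hle : |a - ε / 2| ≤ |b| := by
        rw [abs_of_nonneg (by linarith), abs_of_nonneg (by linarith)]
        linarith
      obtain ⟨γ₁, h₁, hγ₁⟩ := hK _ (hmem (t := -(a - ε / 2)) h0 hγ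
        ⟨by linarith, by linarith⟩ (by rwa [abs_neg]))
      obtain ⟨γ₂, h₂, hγ₂⟩ := hK _ (hmem (t := a - ε / 2) h0 hγ
        ⟨by linarith, by linarith⟩ hle)
      obtain ⟨γ', h0', hγ'⟩ := hγ.exists_extension hv hε ha h₁ hγ₁ h₂ hγ₂
      refine ⟨a + ε / 2, by linarith, ?_, γ', h0'.trans h0, hγ'⟩
      have : ε + k * (ε / 2) ≤ a := (min_le_iff.1 hka).resolve_left hab
      refine (min_le_right _ _).trans ?_
      push_cast
      linarith
  obtain ⟨k, hk⟩ := exists_nat_gt (b / (ε / 2))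
  obtain ⟨a, -, hka, γ, h0, hγ⟩ := hind k
  rw [div_lt_iff₀ (by positivity)] at hk
  have hba : b ≤ a := by
    rcases min_le_iff.1 hka with h | h <;> linarith
  exact ⟨γ, h0, hγ.mono (Ioo_subset_Ioo (neg_le_neg hba) hba)⟩

end Completeness

/-! ### Adapted charts and lifts of constant fields -/

section SubmersionChart

open Set Filter Topology Function

variable {m n : ℕ} {M : Type*} [TopologicalSpace M] [ChartedSpace (EuclideanSpace ℝ (Fin m)) M]

variable (m) in
/-- A smooth chart of `M` whose first component is the given map `p`. -/
structure IsAdaptedChart {d : ℕ} (p : M → EuclideanSpace ℝ (Fin n))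
    (χ : OpenPartialHomeomorph M (EuclideanSpace ℝ (Fin n) × EuclideanSpace ℝ (Fin d))) :
    Prop where
  contMDiffOn : ContMDiffOn (𝓡 m) ((𝓡 n).prod (𝓡 d)) ∞ χ χ.source
  contMDiffOn_symm : ContMDiffOn ((𝓡 n).prod (𝓡 d)) (𝓡 m) ∞ χ.symm χ.target
  fst_apply : ∀ y ∈ χ.source, (χ y).1 = p y

/-- In the submersion normal form, undoing the codomain chart on the first factor turns the
projection into `p` itself. -/
theorem exists_isAdaptedChart {p : M → EuclideanSpace ℝ (Fin n)}
    (hp : Manifold.IsSubmersion (𝓡 m) (𝓡 n) ∞ p) (x : M) :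
    ∃ χ : OpenPartialHomeomorph M
        (EuclideanSpace ℝ (Fin n) × EuclideanSpace ℝ (Fin (m - n))),
      x ∈ χ.source ∧ IsAdaptedChart m p χ := by
  have h := hp.isSubmersionAt x
  have : FiniteDimensional ℝ (EuclideanSpace ℝ (Fin n) × h.complement) :=
    h.equiv.toLinearEquiv.finiteDimensional
  have : FiniteDimensional ℝ h.complement :=
    Module.Finite.of_surjective (LinearMap.snd ℝ (EuclideanSpace ℝ (Fin n)) h.complement)
      LinearMap.snd_surjective
  have hrank : Module.finrank ℝ h.complement = m - n := by
    have := h.equiv.toLinearEquiv.finrank_eq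
    simp only [finrank_euclideanSpace, Fintype.card_fin, Module.finrank_prod] at this
    omega
  let l : h.complement ≃L[ℝ] EuclideanSpace ℝ (Fin (m - n)) :=
    ContinuousLinearEquiv.ofFinrankEq (by simp [hrank])
  let L : EuclideanSpace ℝ (Fin m) ≃L[ℝ]
      EuclideanSpace ℝ (Fin n) × EuclideanSpace ℝ (Fin (m - n)) :=
    h.equiv.trans ((ContinuousLinearEquiv.refl ℝ _).prodCongr l)
  let χ := (h.domChart.trans L.toHomeomorph.toOpenPartialHomeomorph).trans
    (h.codChart.symm.prod (OpenPartialHomeomorph.refl (EuclideanSpace ℝ (Fin (m - n)))))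
  have hL : ∀ u, (L u).1 = (h.equiv u).1 := fun u => rfl
  have hwr : ∀ y ∈ h.domChart.source, h.codChart (p y) = (L (h.domChart y)).1 := by
    intro y hy
    have := h.writtenInCharts (show h.domChart y ∈ (h.domChart.extend (𝓡 m)).target by
      simpa using h.domChart.map_source hy)
    simpa [hy, hL] using this
  have hχ : ∀ y, χ y = (h.codChart.symm (L (h.domChart y)).1, (L (h.domChart y)).2) :=
    fun y => rfl
  have hsource : χ.source = h.domChart.source := by
    ext y
    simp only [χ, mfld_simps, mem_inter_iff, mem_preimage]
    refine ⟨fun hy => hy.1, fun hy => ⟨hy, ?_⟩⟩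
    change (L (h.domChart y)).1 ∈ h.codChart.target
    rw [← hwr y hy]
    exact h.codChart.map_source (h.source_subset_preimage_source hy)
  have hLc : ContMDiff (𝓡 m) ((𝓡 n).prod (𝓡 (m - n))) ∞ L := by
    rw [← modelWithCornersSelf_prod, chartedSpaceSelf_prod, contMDiff_iff_contDiff]
    exact L.contDiff
  have hLsc : ContMDiff ((𝓡 n).prod (𝓡 (m - n))) (𝓡 m) ∞ L.symm := by
    rw [← modelWithCornersSelf_prod, chartedSpaceSelf_prod, contMDiff_iff_contDiff]
    exact L.symm.contDiff
  refine ⟨χ, hsource ▸ h.mem_domChart_source, ?_, ?_, ?_⟩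
  · rw [hsource]
    have h1 : ContMDiffOn (𝓡 m) ((𝓡 n).prod (𝓡 (m - n))) ∞ (fun y => L (h.domChart y))
        h.domChart.source :=
      hLc.comp_contMDiffOn (contMDiffOn_of_mem_maximalAtlas h.domChart_mem_maximalAtlas)
    have h2 : MapsTo (fun y => (L (h.domChart y)).1) h.domChart.source h.codChart.target := by
      intro y hy
      simp only [← hwr y hy]
      exact h.codChart.map_source (h.source_subset_preimage_source hy)
    exact ((contMDiffOn_symm_of_mem_maximalAtlas h.codChart_mem_maximalAtlas).comp
      (contMDiff_fst.comp_contMDiffOn h1) h2).prodMk (contMDiff_snd.comp_contMDiffOn h1)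
  · have h1 : ContMDiffOn ((𝓡 n).prod (𝓡 (m - n))) (𝓡 m) ∞
        (fun q => L.symm (h.codChart q.1, q.2)) χ.target := by
      refine hLsc.comp_contMDiffOn (ContMDiffOn.prodMk ?_ contMDiff_snd.contMDiffOn)
      refine (contMDiffOn_of_mem_maximalAtlas h.codChart_mem_maximalAtlas).comp
        contMDiff_fst.contMDiffOn fun q hq => ?_
      simp only [χ, mfld_simps] at hq
      exact hq.1
    refine (contMDiffOn_symm_of_mem_maximalAtlas h.domChart_mem_maximalAtlas).comp h1
      fun q hq => ?_
    simp only [χ, mfld_simps] at hq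
    exact hq.2
  · intro y hy
    rw [hsource] at hy
    rw [hχ, ← hwr y hy]
    exact h.codChart.left_inv (h.source_subset_preimage_source hy)

variable [IsManifold (𝓡 m) ∞ M]

/-- Freezing the second coordinate of `χ y` gives a local section `h y` of `p` through `y`; its
derivative sends `e` to a lift. -/
theorem IsAdaptedChart.exists_local_lift {d : ℕ} {p : M → EuclideanSpace ℝ (Fin n)}
    (hp : ContMDiff (𝓡 m) (𝓡 n) ∞ p)
    {χ : OpenPartialHomeomorph M (EuclideanSpace ℝ (Fin n) × EuclideanSpace ℝ (Fin d))}
    (hχ : IsAdaptedChart m p χ) (e : EuclideanSpace ℝ (Fin n)) :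
    ∃ s : ∀ x : M, TangentSpace (𝓡 m) x,
      ContMDiffOn (𝓡 m) (𝓡 m).tangent ∞ (fun x => (⟨x, s x⟩ : TangentBundle (𝓡 m) M)) χ.source ∧
        ∀ y ∈ χ.source, mfderiv (𝓡 m) (𝓡 n) p y (s y) = e := by
  let h : M → EuclideanSpace ℝ (Fin n) → M := fun y z => χ.symm (z, (χ y).2)
  have hpt : ∀ y ∈ χ.source, (p y, (χ y).2) = χ y := fun y hy => by rw [← hχ.fst_apply y hy]
  have hh : ∀ y ∈ χ.source, h y (p y) = y := fun y hy => by
    simp only [h, hpt y hy]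
    exact χ.left_inv hy
  have hsmooth : ∀ y ∈ χ.source,
      ContMDiffAt ((𝓡 m).prod (𝓡 n)) (𝓡 m) ∞ (uncurry h) (y, p y) := by
    intro y hy
    have h1 : ContMDiffAt ((𝓡 n).prod (𝓡 d)) (𝓡 m) ∞ χ.symm (p y, (χ y).2) := by
      rw [hpt y hy]
      exact hχ.contMDiffOn_symm.contMDiffAt (χ.open_target.mem_nhds (χ.map_source hy))
    have h2 : ContMDiffAt (𝓡 m) ((𝓡 n).prod (𝓡 d)) ∞ χ y :=
      hχ.contMDiffOn.contMDiffAt (χ.open_source.mem_nhds hy)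
    exact ContMDiffAt.comp (y, p y) (f := fun q : M × EuclideanSpace ℝ (Fin n) =>
      (q.2, (χ q.1).2)) h1 (contMDiffAt_snd.prodMk
        (contMDiffAt_snd.comp (y, p y) (h2.comp (y, p y) contMDiffAt_fst)))
  have hM : IsManifold (𝓡 m) 1 M := .of_le (n := ∞) (by norm_cast)
  let s : ∀ x : M, TangentSpace (𝓡 m) x := fun y =>
    (mfderiv (𝓡 n) (𝓡 m) (h y) (p y) e : EuclideanSpace ℝ (Fin m))
  refine ⟨s, fun y₀ hy₀ => ?_, fun y hy => ?_⟩
  · refine ContMDiffAt.contMDiffWithinAt ?_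
    refine (Bundle.contMDiffAt_section (F := EuclideanSpace ℝ (Fin m)) y₀).2 ?_
    have h1 := ((hsmooth y₀ hy₀).mfderiv h p (hp y₀) (m := ∞) (by simp)).clm_apply
      (contMDiffAt_const (c := e))
    refine h1.congr_of_eventuallyEq ?_
    filter_upwards [χ.open_source.mem_nhds hy₀,
      (chartAt (EuclideanSpace ℝ (Fin m)) y₀).open_source.mem_nhds
        (mem_chart_source _ y₀)] with y hy hy'
    -- `h y (p y) = y` is not definitional, so base points are generalised before being identified.
    have key : ∀ z z₀ : M, z = y → z₀ = y₀ → ∀ w : EuclideanSpace ℝ (Fin m),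
        (trivializationAt (EuclideanSpace ℝ (Fin m)) (TangentSpace (𝓡 m)) y₀
          (⟨y, w⟩ : TangentBundle (𝓡 m) M)).2 =
        (trivializationAt (EuclideanSpace ℝ (Fin m)) (TangentSpace (𝓡 m)) z₀).continuousLinearMapAt
          ℝ z w := by
      rintro z z₀ rfl rfl w
      rw [Bundle.Trivialization.continuousLinearMapAt_apply,
        Bundle.Trivialization.coe_linearMapAt_of_mem _ (by simpa using hy')]
    have hsymm : (trivializationAt (EuclideanSpace ℝ (Fin n)) (TangentSpace (𝓡 n))
        (p y₀)).symmL ℝ (p y) e = e := by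
      rw [TangentBundle.symmL_model_space]
      rfl
    refine (key _ _ (hh y hy) (hh y₀ hy₀) _).trans ?_
    exact congrArg (fun w => (trivializationAt (EuclideanSpace ℝ (Fin m)) (TangentSpace (𝓡 m))
      (h y₀ (p y₀))).continuousLinearMapAt ℝ (h y (p y))
        (mfderiv (𝓡 n) (𝓡 m) (h y) (p y) w)) hsymm.symm
  · have hcomp : MDifferentiableAt (𝓡 n) (𝓡 m) (h y) (p y) :=
      (ContMDiffAt.comp (p y) (hsmooth y hy)
        (contMDiffAt_const.prodMk contMDiffAt_id)).mdifferentiableAt (by simp)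
    have hpd : MDifferentiableAt (𝓡 m) (𝓡 n) p (h y (p y)) := hp.mdifferentiableAt (by simp)
    have hev : p ∘ h y =ᶠ[𝓝 (p y)] id := by
      have hc : ContinuousAt (fun z : EuclideanSpace ℝ (Fin n) => (z, (χ y).2)) (p y) := by
        fun_prop
      filter_upwards [hc.eventually (χ.open_target.mem_nhds
        (show (p y, (χ y).2) ∈ χ.target by rw [hpt y hy]; exact χ.map_source hy))] with z hz
      simp only [comp_apply, h, ← hχ.fst_apply _ (χ.map_target hz), χ.right_inv hz, id]
    have h2 : mfderiv (𝓡 n) (𝓡 n) (p ∘ h y) (p y) e = e := by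
      rw [hev.mfderiv_eq, mfderiv_id]
      rfl
    have key : ∀ z : M, z = y → ∀ w : EuclideanSpace ℝ (Fin m),
        (mfderiv (𝓡 m) (𝓡 n) p y : EuclideanSpace ℝ (Fin m) →L[ℝ] EuclideanSpace ℝ (Fin n)) w =
        (mfderiv (𝓡 m) (𝓡 n) p z : EuclideanSpace ℝ (Fin m) →L[ℝ] EuclideanSpace ℝ (Fin n)) w := by
      rintro z rfl w
      rfl
    exact (key _ (hh y hy) _).trans ((mfderiv_comp_apply (p y) hpd hcomp e).symm.trans h2)

theorem exists_contMDiff_lift [T2Space M] [SigmaCompactSpace M]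
    {p : M → EuclideanSpace ℝ (Fin n)} (hp : Manifold.IsSubmersion (𝓡 m) (𝓡 n) ∞ p)
    (e : EuclideanSpace ℝ (Fin n)) :
    ∃ v : ∀ x : M, TangentSpace (𝓡 m) x,
      ContMDiff (𝓡 m) (𝓡 m).tangent ∞ (fun x => (⟨x, v x⟩ : TangentBundle (𝓡 m) M)) ∧
        ∀ y, mfderiv (𝓡 m) (𝓡 n) p y (v y) = e := by
  have : IsManifold (𝓡 m) 1 M := .of_le (n := ∞) (by norm_cast)
  obtain ⟨s, hs⟩ := exists_contMDiffSection_forall_mem_convex_of_local (n := ⊤) (𝓡 m)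
    (TangentSpace (𝓡 m) (M := M))
    (fun x => {w | mfderiv (𝓡 m) (𝓡 n) p x w = e})
    (fun x w₁ h₁ w₂ h₂ a b _ _ hab => by
      simp only [mem_ofPred_eq] at h₁ h₂ ⊢
      rw [map_add, map_smul, map_smul, h₁, h₂]
      exact Convex.combo_self hab e)
    (fun x => by
      obtain ⟨χ, hx, hχ⟩ := exists_isAdaptedChart hp x
      obtain ⟨s, hs, hse⟩ := hχ.exists_local_lift hp.contMDiff e
      exact ⟨χ.source, χ.open_source.mem_nhds hx, s, hs, hse⟩)
  exact ⟨s, s.contMDiff, hs⟩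

end SubmersionChart

/-! ### The manifold structure on a fibre -/

section FiberManifold

open Set Filter Topology Function

variable {m n d : ℕ} {M : Type*} [TopologicalSpace M] [ChartedSpace (EuclideanSpace ℝ (Fin m)) M]
  {p : M → EuclideanSpace ℝ (Fin n)} {b : EuclideanSpace ℝ (Fin n)}

open Classical in
/-- The chart of the fibre of `p` over `b` induced by an adapted chart. -/
noncomputable def IsAdaptedChart.fiberChart
    {χ : OpenPartialHomeomorph M (EuclideanSpace ℝ (Fin n) × EuclideanSpace ℝ (Fin d))}
    (hχ : IsAdaptedChart m p χ) (y₀ : p ⁻¹' {b}) :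
    OpenPartialHomeomorph (p ⁻¹' {b}) (EuclideanSpace ℝ (Fin d)) where
  toFun y := (χ y).2
  -- Off the target the value `y₀` is arbitrary.
  invFun c := if h : (b, c) ∈ χ.target then
    ⟨χ.symm (b, c), by
      rw [mem_preimage, ← hχ.fst_apply _ (χ.map_target h), χ.right_inv h]; rfl⟩ else y₀
  source := {y | (y : M) ∈ χ.source}
  target := {c | (b, c) ∈ χ.target}
  map_source' y hy := by
    have : (b, (χ y).2) = χ y := Prod.ext ((hχ.fst_apply _ hy).trans y.2).symm rfl
    simpa [this] using χ.map_source hy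
  map_target' c hc := by
    simp only [mem_ofPred_eq] at hc ⊢
    rw [dif_pos hc]
    exact χ.map_target hc
  left_inv' y hy := by
    have : (b, (χ y).2) = χ y := Prod.ext ((hχ.fst_apply _ hy).trans y.2).symm rfl
    have hmem : (b, (χ y).2) ∈ χ.target := this ▸ χ.map_source hy
    rw [dif_pos hmem]
    exact Subtype.ext (by simp only [this]; exact χ.left_inv hy)
  right_inv' c hc := by
    simp only [mem_ofPred_eq] at hc
    rw [dif_pos hc]
    simp only [χ.right_inv hc]
  open_source := χ.open_source.preimage continuous_subtype_val
  open_target := χ.open_target.preimage (Continuous.prodMk_right b)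
  continuousOn_toFun := continuous_snd.comp_continuousOn
    (χ.continuousOn.comp continuous_subtype_val.continuousOn fun _ hy => hy)
  continuousOn_invFun := by
    rw [Topology.IsInducing.subtypeVal.continuousOn_iff]
    refine (χ.continuousOn_symm.comp (Continuous.prodMk_right b).continuousOn
      fun c hc => hc).congr fun c hc => ?_
    replace hc : (b, c) ∈ χ.target := hc
    simp only [comp_apply, dif_pos hc]

variable {χ : OpenPartialHomeomorph M (EuclideanSpace ℝ (Fin n) × EuclideanSpace ℝ (Fin d))}
  (hχ : IsAdaptedChart m p χ) (y₀ : p ⁻¹' {b})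

theorem IsAdaptedChart.coe_fiberChart_symm {c : EuclideanSpace ℝ (Fin d)}
    (hc : (b, c) ∈ χ.target) : ((hχ.fiberChart y₀).symm c : M) = χ.symm (b, c) :=
  congrArg Subtype.val (dif_pos hc)

theorem IsAdaptedChart.contMDiffOn_coe_fiberChart_symm :
    ContMDiffOn (𝓡 d) (𝓡 m) ∞ (fun c => ((hχ.fiberChart y₀).symm c : M))
      (hχ.fiberChart y₀).target := by
  have h : ContMDiffOn (𝓡 d) (𝓡 m) ∞ (fun c => χ.symm (b, c)) (hχ.fiberChart y₀).target :=
    hχ.contMDiffOn_symm.comp (contMDiff_const.prodMk contMDiff_id).contMDiffOn fun c hc => hc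
  exact h.congr fun c hc => hχ.coe_fiberChart_symm y₀ hc

/-- The charted space structure on a fibre given by a family of adapted charts covering it. -/
@[reducible]
noncomputable def fiberChartedSpace
    {χ : p ⁻¹' {b} → OpenPartialHomeomorph M
      (EuclideanSpace ℝ (Fin n) × EuclideanSpace ℝ (Fin d))}
    (hχ : ∀ y, IsAdaptedChart m p (χ y)) (hmem : ∀ y : p ⁻¹' {b}, (y : M) ∈ (χ y).source) :
    ChartedSpace (EuclideanSpace ℝ (Fin d)) (p ⁻¹' {b}) where
  atlas := range fun y => (hχ y).fiberChart y
  chartAt y := (hχ y).fiberChart y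
  mem_chart_source y := hmem y
  chart_mem_atlas y := mem_range_self y

section

variable {χ : p ⁻¹' {b} → OpenPartialHomeomorph M
      (EuclideanSpace ℝ (Fin n) × EuclideanSpace ℝ (Fin d))}
  (hχ : ∀ y, IsAdaptedChart m p (χ y)) (hmem : ∀ y : p ⁻¹' {b}, (y : M) ∈ (χ y).source)

theorem isManifold_fiber :
    letI := fiberChartedSpace hχ hmem
    IsManifold (𝓡 d) ∞ (p ⁻¹' {b}) := by
  let := fiberChartedSpace hχ hmem
  refine isManifold_of_contDiffOn _ _ _ ?_
  rintro _ _ ⟨y, rfl⟩ ⟨z, rfl⟩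
  simp only [mfld_simps]
  rw [← contMDiffOn_iff_contDiffOn]
  refine (contMDiff_snd (I := 𝓡 n) (J := 𝓡 d)).comp_contMDiffOn
    (f := fun c => χ z ((hχ y).fiberChart y |>.symm c)) ?_
  refine (hχ z).contMDiffOn.comp (((hχ y).contMDiffOn_coe_fiberChart_symm y).mono
    fun c hc => hc.1) fun c hc => hc.2

theorem contMDiff_coe_fiber [IsManifold (𝓡 m) ∞ M] :
    letI := fiberChartedSpace hχ hmem
    ContMDiff (𝓡 d) (𝓡 m) ∞ (fun y : p ⁻¹' {b} => (y : M)) := by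
  let := fiberChartedSpace hχ hmem
  have := isManifold_fiber hχ hmem
  intro y
  have h1 : ContMDiffAt (𝓡 d) (𝓡 d) ∞ ((hχ y).fiberChart y) y := contMDiffAt_extChartAt
  have h2 := ((hχ y).contMDiffOn_coe_fiberChart_symm y).contMDiffAt
    (((hχ y).fiberChart y).open_target.mem_nhds
      (((hχ y).fiberChart y).map_source (hmem y)))
  refine (h2.comp y h1).congr_of_eventuallyEq ?_
  filter_upwards [((hχ y).fiberChart y).open_source.mem_nhds (hmem y)] with z hz
  simp only [comp_apply, ((hχ y).fiberChart y).left_inv hz]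

/-- Each fibre chart is the restriction of a smooth map, the second component of `χ`, on an open
subset of `M`. -/
theorem contMDiff_codRestrict_fiber {E' H' N : Type*} [NormedAddCommGroup E'] [NormedSpace ℝ E']
    [TopologicalSpace H'] {I : ModelWithCorners ℝ E' H'} [TopologicalSpace N] [ChartedSpace H' N]
    {f : N → p ⁻¹' {b}} (hf : ContMDiff I (𝓡 m) ∞ (fun x => (f x : M))) :
    letI := fiberChartedSpace hχ hmem
    ContMDiff I (𝓡 d) ∞ f := by
  let := fiberChartedSpace hχ hmem
  intro x
  rw [contMDiffAt_iff_target]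
  refine ⟨(Topology.IsInducing.subtypeVal.continuous_iff.2 hf.continuous).continuousAt, ?_⟩
  have h1 : ContMDiffAt (𝓡 m) ((𝓡 n).prod (𝓡 d)) ∞ (χ (f x)) (f x : M) :=
    (hχ (f x)).contMDiffOn.contMDiffAt ((χ (f x)).open_source.mem_nhds (hmem (f x)))
  exact contMDiffAt_snd.comp x (h1.comp x (hf x))

end

end FiberManifold

/-! ### Lifting translations of the base -/

section Translation

open Set Function

variable {m n : ℕ} {M : Type*} [TopologicalSpace M] [T2Space M] [SigmaCompactSpace M]
  [ChartedSpace (EuclideanSpace ℝ (Fin m)) M] [IsManifold (𝓡 m) ∞ M]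
  {p : M → EuclideanSpace ℝ (Fin n)}

/-- The translation by `e` of the base of a proper submersion lifts to a smooth flow. -/
theorem exists_contMDiff_flow_lift (hp : Manifold.IsSubmersion (𝓡 m) (𝓡 n) ∞ p)
    (hprop : IsProperMap p) (e : EuclideanSpace ℝ (Fin n)) :
    ∃ Θ : M → ℝ → M, ContMDiff ((𝓡 m).prod 𝓘(ℝ, ℝ)) (𝓡 m) ∞ (uncurry Θ) ∧
      (∀ x, Θ x 0 = x) ∧ (∀ x s t, Θ x (s + t) = Θ (Θ x s) t) ∧
      ∀ x t, p (Θ x t) = p x + t • e := by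
  obtain ⟨v, hv, hpv⟩ := exists_contMDiff_lift hp e
  have hpd : MDifferentiable (𝓡 m) (𝓡 n) p := hp.contMDiff.mdifferentiable (by simp)
  choose Θ h0 hΘ using hprop.exists_isMIntegralCurve hv hpd hpv
  refine ⟨Θ, contMDiff_flow hv h0 hΘ, h0, flow_add hv h0 hΘ, fun x t => ?_⟩
  have := ((hΘ x).isMIntegralCurveOn (Ioo (-(|t| + 1)) (|t| + 1))).eq_add_smul_of_mfderiv_eq
    hpd hpv (t := t) (abs_lt.1 (lt_add_one _))
  rwa [h0] at this

theorem exists_contMDiff_translation_lift (hp : Manifold.IsSubmersion (𝓡 m) (𝓡 n) ∞ p)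
    (hprop : IsProperMap p) (S : Finset (Fin n)) :
    ∃ A B : EuclideanSpace ℝ (Fin n) × M → M,
      ContMDiff ((𝓡 n).prod (𝓡 m)) (𝓡 m) ∞ A ∧ ContMDiff ((𝓡 n).prod (𝓡 m)) (𝓡 m) ∞ B ∧
      (∀ x y, A (x, B (x, y)) = y) ∧ (∀ x y, B (x, A (x, y)) = y) ∧
      ∀ x y, p (A (x, y)) = p y + ∑ i ∈ S, x i • EuclideanSpace.single i (1 : ℝ) := by
  induction S using Finset.induction_on with
  | empty => exact ⟨Prod.snd, Prod.snd, contMDiff_snd, contMDiff_snd, by simp⟩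
  | insert i S hi ih =>
    obtain ⟨A, B, hA, hB, hAB, hBA, hpA⟩ := ih
    obtain ⟨Θ, hΘ, h0, hadd, hpΘ⟩ :=
      exists_contMDiff_flow_lift hp hprop (EuclideanSpace.single i (1 : ℝ))
    have hcoord : ContMDiff ((𝓡 n).prod (𝓡 m)) 𝓘(ℝ, ℝ) ∞
        (fun q : EuclideanSpace ℝ (Fin n) × M => q.1 i) :=
      (EuclideanSpace.proj (𝕜 := ℝ) i).contMDiff.comp contMDiff_fst
    -- The new flow acts first in `A`, so its inverse acts last in `B`; no commutation is needed.
    refine ⟨fun q => A (q.1, Θ q.2 (q.1 i)), fun q => Θ (B q) (-q.1 i), ?_, ?_, ?_, ?_, ?_⟩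
    · exact hA.comp (contMDiff_fst.prodMk (hΘ.comp (contMDiff_snd.prodMk hcoord)))
    · exact hΘ.comp (hB.prodMk (by simpa using hcoord.neg))
    · intro x y
      simp only [← hadd, neg_add_cancel, h0, hAB]
    · intro x y
      simp only [hBA, ← hadd, add_neg_cancel, h0]
    · intro x y
      simp only [hpA, hpΘ, Finset.sum_insert hi, add_assoc]

end Translation

/-! ### The trivialisation -/

theorem IsProperMap.sigmaCompactSpace {X Y : Type*} [TopologicalSpace X] [TopologicalSpace Y]
    [SigmaCompactSpace Y] {f : X → Y} (hf : IsProperMap f) : SigmaCompactSpace X := by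
  refine ⟨⟨fun k => f ⁻¹' compactCovering Y k,
    fun k => hf.isCompact_preimage (isCompact_compactCovering Y k), ?_⟩⟩
  rw [← Set.preimage_iUnion, iUnion_compactCovering, Set.preimage_univ]

theorem theorem0p2 {m n : ℕ} {M : Type*} [TopologicalSpace M] [T2Space M]
    [ChartedSpace (EuclideanSpace ℝ (Fin m)) M] [IsManifold (𝓡 m) ∞ M]
    (p : M → EuclideanSpace ℝ (Fin n))
    (hp : IsSmoothFamily (m := m) (n := n) p) :
    IsTrivialFamily (m := m) (n := n) p := by
  have hsub := hp.isSubmersion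
  have hprop := hp.isProperMap
  -- The partition of unity needs σ-compactness, which properness transfers from the base.
  have := hprop.sigmaCompactSpace
  obtain ⟨A, B, hA, hB, hAB, hBA, hpA⟩ :=
    exists_contMDiff_translation_lift hsub hprop Finset.univ
  have hsum : ∀ x : EuclideanSpace ℝ (Fin n),
      ∑ i, x i • EuclideanSpace.single i (1 : ℝ) = x := fun x => by
    simpa using (EuclideanSpace.basisFun (Fin n) ℝ).sum_repr x
  simp only [hsum] at hpA
  have hpB : ∀ x y, p (B (x, y)) = p y - x := fun x y => by
    rw [eq_sub_iff_add_eq, ← hpA, hAB]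
  choose χ hmem hχ using fun y : p ⁻¹' {(0 : EuclideanSpace ℝ (Fin n))} =>
    exists_isAdaptedChart hsub (y : M)
  let := fiberChartedSpace hχ hmem
  have hι := contMDiff_coe_fiber hχ hmem
  -- Truncated subtraction is harmless: `m < n` forces `M`, hence the fibre, to be empty.
  refine ⟨m - n, p ⁻¹' {0}, inferInstance, inferInstance,
    isCompact_iff_compactSpace.1 (hprop.isCompact_preimage isCompact_singleton),
    fiberChartedSpace hχ hmem, isManifold_fiber hχ hmem, ?_⟩
  let Φ : Diffeomorph (𝓡 m) ((𝓡 n).prod (𝓡 (m - n))) M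
      (EuclideanSpace ℝ (Fin n) × (p ⁻¹' {(0 : EuclideanSpace ℝ (Fin n))})) ∞ :=
    { toFun := fun y => (p y, ⟨B (p y, y), by simp [hpB]⟩)
      invFun := fun q => A (q.1, q.2)
      left_inv := fun y => hAB _ _
      right_inv := fun q => by
        have hq : p (A (q.1, q.2)) = q.1 := by
          rw [hpA, show p q.2 = 0 from q.2.2, zero_add]
        refine Prod.ext hq (Subtype.ext ?_)
        simp only [hq, hBA]
      contMDiff_toFun := hsub.contMDiff.prodMk (contMDiff_codRestrict_fiber hχ hmem
        (hB.comp (hsub.contMDiff.prodMk contMDiff_id)))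
      contMDiff_invFun := hA.comp (contMDiff_fst.prodMk (hι.comp contMDiff_snd)) }
  exact ⟨Φ, fun _ => rfl⟩
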